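/- Let $\mathbb F$ be an algebraically closed field of characteristic zero, let $\overline{\mathbb F(x)}$ be an algebraic closure of $\mathbb F(x)$, and let $\sigma_x$ be any automorphism of $\overline{\mathbb F(x)}$ extending the shift $a(x)\mapsto a(x+1)$ of $\mathbb F(x)$. On $\overline{\mathbb F(x)}(y)$ let $\sigma_x$ act on coefficients with $\sigma_x(y)=y$, and let $\sigma_y$ be the automorphism that fixes $\overline{\mathbb F(x)}$ and sends $y$ to $y+1$. An element $f\in\overline{\mathbb F(x)}(y)$ is called $(\sigma_x,\sigma_y)$-summable in $\overline{\mathbb F(x)}(y)$ if $f=\sigma_x(g)-g+\sigma_y(h)-h$ for some $g,h\in\overline{\mathbb F(x)}(y)$. Let $j\ge 1$ be an integer and let $$f=\sum_{i=1}^m\frac{\alpha_i}{(y-\beta_i)^j},\qquad \alpha_i,\beta_i\in\overline{\mathbb F(x)},\quad \alpha_i\ne 0,$$ where $\beta_i-\sigma_x^n(\beta_{i'})\notin\mathbb Z$ for all $1\le i<i'\le m$ and all $n\in\mathbb Z$. (1) $f$ is $(\sigma_x,\sigma_y)$-summable in $\overline{\mathbb F(x)}(y)$ if and only if for each $i\in\{1,\dots,m\}$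 there are $s_i\in\mathbb Z$, an integer $t_i\ge 1$ and $c_i\in\mathbb F$ such that $\beta_i=\frac{s_i}{t_i}x+c_i$ and $\alpha_i=\sigma_x^{t_i}(\gamma_i)-\gamma_i$ for some $\gamma_i\in\overline{\mathbb F(x)}$. (2) If moreover $\alpha_i\in\mathbb F(x)(\beta_i)$ for each $i$, then $f$ is $(\sigma_x,\sigma_y)$-summable in $\overline{\mathbb F(x)}(y)$ if and only if the condition in (1) holds with $\gamma_i\in\mathbb F(x)$ for each $i$. -/

import Mathlib

/-- The field automorphism of `k(X)` induced by an automorphism of the polynomial ring `k[X]`. -/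
noncomputable def ratFuncAut {k : Type*} [Field k] (e : Polynomial k ≃+* Polynomial k) :
    RingAut (RatFunc k) :=
  IsFractionRing.ringEquivOfRingEquiv (K := RatFunc k) (L := RatFunc k) e

/-- The shift operator `f(X) ↦ f(X + 1)` on `k(X)`; it fixes `k`. It serves both as the shift in `x`
on `F(x)` and as the shift in `y` on `E(y)`. -/
noncomputable def ratFuncShift (k : Type*) [Field k] : RingAut (RatFunc k) :=
  ratFuncAut (Polynomial.algEquivAevalXAddC (1 : k)).toRingEquiv

/-- An automorphism `σ` of `k` acting on the coefficients of elements of `k(X)`; it fixes `X`. -/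
noncomputable def ratFuncCoeffAut {k : Type*} [Field k] (σ : RingAut k) : RingAut (RatFunc k) :=
  ratFuncAut (Polynomial.mapEquiv σ)

/-- `f` is `(φ, ψ)`-summable in `L`. -/
def IsSummablePair {L : Type*} [Field L] (φ ψ : RingAut L) (f : L) : Prop :=
  ∃ g h : L, f = (φ g - g) + (ψ h - h)

/-- `σ` is an extension to `E ⊇ F(x)` of the shift operator `x ↦ x + 1` of `F(x)`. -/
def ExtendsShift (F : Type*) [Field F] {E : Type*} [Field E] [Algebra (RatFunc F) E]
    (σ : RingAut E) : Prop :=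
  ∀ a : RatFunc F, σ (algebraMap (RatFunc F) E a) = algebraMap (RatFunc F) E (ratFuncShift F a)

/-! The discrete residue `D_b f` of a rational function `f` of `y` is the sum of its coefficients
of `1 / (y - b') ^ j` over `b' ∈ b + ℤ`. It vanishes on `σ_y(h) - h` and satisfies
`D_{σ b} (σ g) = σ (D_b g)`, so `f = σ g - g + σ_y(h) - h` gives
`D_{σ b} f = σ (D_b g) - D_{σ b} g`.

Suppose the `σ`-orbit of `β + ℤ` meets the poles of `f` only in `β + ℤ`. If it is infinite, then
`D g` vanishes far out along it in both directions, hence at `σ⁻¹ β` and at `β`, and so `D_β f = 0`.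
If it is periodic, `σ ^ t β = β + s` with `t ≥ 1` minimal, then transporting `γ = D_β g` once around
it yields `D_β f = σ ^ t γ - γ`. Conversely, `(σ ^ t γ - γ) / (y - β) ^ j` telescopes.

The equation `σ ^ t β = β + s` says that `β - (s / t) x` is fixed by `σ ^ t`. A fixed element is
algebraic over `F`: otherwise `x` would be algebraic over a field fixed by `σ ^ t`, although its
orbit `x + n t` is infinite. For such `β` we have `F(x)(β) = F(x)`, so `α` is rational, and then a
rational `γ` can be read off from the minimal polynomial of any `γ`. -/

section RingAut

variable {R : Type*} [Ring R]

theorem exists_apply_sub_eq_pow_apply_sub (φ : RingAut R) (n : ℕ) (u : R) :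
    ∃ g, φ g - g = (φ ^ n) u - u := by
  refine ⟨∑ i ∈ Finset.range n, (φ ^ i) u, ?_⟩
  rw [map_sum, ← Finset.sum_sub_distrib]
  simpa only [pow_succ', RingAut.mul_apply, pow_zero, RingAut.one_apply] using
    Finset.sum_range_sub (fun i => (φ ^ i) u) n

theorem exists_apply_sub_eq_zpow_apply_sub (φ : RingAut R) (n : ℤ) (u : R) :
    ∃ g, φ g - g = (φ ^ n) u - u := by
  obtain ⟨n, rfl | rfl⟩ := n.eq_nat_or_neg
  · simpa only [zpow_natCast] using exists_apply_sub_eq_pow_apply_sub φ n u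
  · obtain ⟨g, hg⟩ := exists_apply_sub_eq_pow_apply_sub φ n ((φ ^ (-n : ℤ)) u)
    rw [← RingAut.mul_apply, ← zpow_natCast, ← zpow_add, add_neg_cancel, zpow_zero,
      RingAut.one_apply] at hg
    exact ⟨-g, by rw [map_neg, neg_sub_neg, ← neg_sub, hg, neg_sub]⟩

theorem exists_pow_apply_eq_add_intCast {σ : RingAut R} {b : R} {n : ℤ} (hn : n ≠ 0) {s : ℤ}
    (h : (σ ^ n) b = b + s) : ∃ t : ℕ, 1 ≤ t ∧ ∃ s : ℤ, (σ ^ t) b = b + s := by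
  obtain ⟨t, rfl | rfl⟩ := n.eq_nat_or_neg
  · exact ⟨t, by lia, s, mod_cast h⟩
  · refine ⟨t, by lia, -s, ?_⟩
    have := congrArg (σ ^ (t : ℤ)) h
    rw [← RingAut.mul_apply, ← zpow_add, add_neg_cancel, zpow_zero, RingAut.one_apply, map_add,
      map_intCast, zpow_natCast] at this
    rw [Int.cast_neg]
    exact eq_add_neg_of_add_eq this.symm

end RingAut

section Summable

variable {L : Type*} [Field L] {φ ψ : RingAut L}

theorem IsSummablePair.add {f g : L} (hf : IsSummablePair φ ψ f) (hg : IsSummablePair φ ψ g) :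
    IsSummablePair φ ψ (f + g) := by
  obtain ⟨u, v, rfl⟩ := hf
  obtain ⟨u', v', rfl⟩ := hg
  exact ⟨u + u', v + v', by simp only [map_add]; ring⟩

theorem IsSummablePair.sum {ι : Type*} (s : Finset ι) {f : ι → L}
    (hf : ∀ i ∈ s, IsSummablePair φ ψ (f i)) : IsSummablePair φ ψ (∑ i ∈ s, f i) :=
  Finset.sum_induction f _ (fun _ _ => .add) ⟨0, 0, by simp⟩ hf

theorem isSummablePair_zpow_apply_sub (m n : ℤ) (u : L) :
    IsSummablePair φ ψ ((ψ ^ n) ((φ ^ m) u) - u) := by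
  obtain ⟨g, hg⟩ := exists_apply_sub_eq_zpow_apply_sub φ m u
  obtain ⟨h, hh⟩ := exists_apply_sub_eq_zpow_apply_sub ψ n ((φ ^ m) u)
  exact ⟨g, h, by rw [hg, hh]; ring⟩

end Summable

section RatFuncAut

open Polynomial

open scoped RatFunc

variable {k : Type*} [Field k]

@[simp]
theorem ratFuncAut_algebraMap (e : k[X] ≃+* k[X]) (p : k[X]) :
    ratFuncAut e (algebraMap k[X] (RatFunc k) p) = algebraMap k[X] (RatFunc k) (e p) :=
  IsFractionRing.ringEquivOfRingEquiv_algebraMap e p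

theorem ratFuncShift_eq_laurent (g : RatFunc k) : ratFuncShift k g = RatFunc.laurent 1 g := by
  induction g using RatFunc.induction_on with
  | f p q => simp [ratFuncShift, taylor_apply, aeval_def, comp, algebraMap_eq]

theorem ratFuncShift_zpow_eq_laurent (n : ℤ) (g : RatFunc k) :
    (ratFuncShift k ^ n) g = RatFunc.laurent (n : k) g := by
  induction n generalizing g with
  | zero => simp
  | succ n ih =>
    rw [zpow_add_one, RingAut.mul_apply, ratFuncShift_eq_laurent, ih, RatFunc.laurent_laurent,
      Int.cast_add, Int.cast_one]
  | pred n ih =>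
    obtain ⟨g, rfl⟩ := (ratFuncShift k).surjective g
    rw [zpow_sub_one, ← RingAut.mul_apply, inv_mul_cancel_right, ih, ratFuncShift_eq_laurent,
      RatFunc.laurent_laurent, Int.cast_sub, Int.cast_one, sub_add_cancel]

theorem ratFuncCoeffAut_inv (σ : RingAut k) :
    ratFuncCoeffAut σ⁻¹ = (ratFuncCoeffAut σ)⁻¹ := by
  rfl

@[simp]
theorem ratFuncCoeffAut_algebraMap (σ : RingAut k) (p : k[X]) :
    ratFuncCoeffAut σ (algebraMap k[X] (RatFunc k) p) =
      algebraMap k[X] (RatFunc k) (p.map (σ : k →+* k)) :=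
  ratFuncAut_algebraMap _ p

theorem laurent_ratFuncCoeffAut (σ : RingAut k) (b : k) (g : RatFunc k) :
    RatFunc.laurent (σ b) (ratFuncCoeffAut σ g) = ratFuncCoeffAut σ (RatFunc.laurent b g) := by
  induction g using RatFunc.induction_on with
  | f p q => simp [taylor_apply, Polynomial.map_comp]

theorem coe_ratFuncCoeffAut (σ : RingAut k) (g : RatFunc k) :
    (ratFuncCoeffAut σ g : LaurentSeries k) = (g : LaurentSeries k).map (σ : k →+* k) := by
  have coe_poly (p : k[X]) : (ratFuncCoeffAut σ (algebraMap k[X] (RatFunc k) p) :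
      LaurentSeries k) = (algebraMap k[X] (RatFunc k) p : LaurentSeries k).map (σ : k →+* k) := by
    ext n
    rw [ratFuncCoeffAut_algebraMap, HahnSeries.map_coeff, ← RatFunc.coePolynomial,
      ← RatFunc.coePolynomial, ← RatFunc.coe_coe, ← RatFunc.coe_coe, PowerSeries.coeff_coe,
      PowerSeries.coeff_coe, apply_ite (σ : k →+* k), map_zero, Polynomial.coeff_coe,
      Polynomial.coeff_coe, coeff_map]
  induction g using RatFunc.induction_on with
  | f p q hq =>
    set P := algebraMap k[X] (RatFunc k) p
    set Q := algebraMap k[X] (RatFunc k) q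
    have hQ : Q ≠ 0 := by simpa [Q] using hq
    have hσQ : (ratFuncCoeffAut σ Q : LaurentSeries k) ≠ 0 := by simpa using hQ
    refine mul_right_cancel₀ hσQ ?_
    calc (ratFuncCoeffAut σ (P / Q) : LaurentSeries k) * (ratFuncCoeffAut σ Q : RatFunc k)
        = (P : LaurentSeries k).map (σ : k →+* k) := by
          rw [← map_mul, ← map_mul, div_mul_cancel₀ P hQ, coe_poly]
      _ = (((P / Q : RatFunc k) : LaurentSeries k) * (Q : LaurentSeries k)).map (σ : k →+* k) := by
          rw [← map_mul, div_mul_cancel₀ P hQ]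
      _ = _ := by
          rw [coe_poly]
          exact HahnSeries.map_mul ((σ : k →+* k) : k →ₙ+* k)

end RatFuncAut

section PolarCoeff

open Polynomial

open scoped RatFunc

variable {k : Type*} [Field k]

/-- The coefficient of `(X - b) ^ (-j)` in the Laurent expansion of a rational function at `b`. -/
noncomputable def polarCoeff (j : ℕ) (b : k) : RatFunc k →+ k where
  toFun g := (RatFunc.laurent b g : LaurentSeries k).coeff (-j)
  map_zero' := by simp
  map_add' := by simp

theorem polarCoeff_apply (j : ℕ) (b : k) (g : RatFunc k) :
    polarCoeff j b g = (RatFunc.laurent b g : LaurentSeries k).coeff (-j) :=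
  rfl

theorem polarCoeff_laurent (j : ℕ) (b r : k) (g : RatFunc k) :
    polarCoeff j b (RatFunc.laurent r g) = polarCoeff j (b + r) g := by
  rw [polarCoeff_apply, polarCoeff_apply, RatFunc.laurent_laurent]

theorem polarCoeff_ratFuncCoeffAut (j : ℕ) (σ : RingAut k) (b : k) (g : RatFunc k) :
    polarCoeff j (σ b) (ratFuncCoeffAut σ g) = σ (polarCoeff j b g) := by
  rw [polarCoeff_apply, polarCoeff_apply, laurent_ratFuncCoeffAut, coe_ratFuncCoeffAut]
  rfl

theorem polarCoeff_div_of_eval_ne_zero {j : ℕ} [NeZero j] {b : k} (p : k[X]) {q : k[X]}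
    (hq : q.eval b ≠ 0) :
    polarCoeff j b (algebraMap k[X] (RatFunc k) p / algebraMap k[X] (RatFunc k) q) = 0 := by
  have hq₀ : PowerSeries.constantCoeff (taylor b q : PowerSeries k) ≠ 0 := by simpa using hq
  have hq₁ : ((taylor b q : PowerSeries k) : LaurentSeries k) ≠ 0 := by
    rw [Ne, map_eq_zero_iff _ HahnSeries.ofPowerSeries_injective]
    exact fun h => hq₀ (by rw [h, map_zero])
  have expansion :
      (RatFunc.laurent b (algebraMap k[X] (RatFunc k) p / algebraMap k[X] (RatFunc k) q) :
        LaurentSeries k) =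
      ((taylor b p * (taylor b q : PowerSeries k)⁻¹ : PowerSeries k) : LaurentSeries k) := by
    rw [RatFunc.laurent_div, map_div₀, ← RatFunc.coePolynomial, ← RatFunc.coePolynomial,
      ← RatFunc.coe_coe, ← RatFunc.coe_coe, div_eq_iff hq₁, ← map_mul, mul_assoc,
      PowerSeries.inv_mul_cancel _ hq₀, mul_one]
  rw [polarCoeff_apply, expansion, PowerSeries.coeff_coe, if_pos]
  simpa using NeZero.pos j

theorem finite_setOf_polarCoeff_ne_zero (j : ℕ) [NeZero j] (g : RatFunc k) :
    {b : k | polarCoeff j b g ≠ 0}.Finite := by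
  refine (g.denom.rootSet_finite k).subset fun b hb => ?_
  contrapose! hb
  have hg : g.denom.eval b ≠ 0 := by simpa [mem_rootSet, g.denom_ne_zero] using hb
  simpa [RatFunc.num_div_denom] using polarCoeff_div_of_eval_ne_zero (j := j) g.num hg

/-- The partial fraction `a / (X - b) ^ j`. -/
noncomputable def polarTerm (j : ℕ) (a b : k) : RatFunc k :=
  RatFunc.C a / (RatFunc.X - RatFunc.C b) ^ j

theorem polarTerm_sub (j : ℕ) (a a' b : k) :
    polarTerm j (a - a') b = polarTerm j a b - polarTerm j a' b := by
  simp only [polarTerm, map_sub, sub_div]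

theorem laurent_polarTerm (j : ℕ) (r a b : k) :
    RatFunc.laurent r (polarTerm j a b) = polarTerm j a (b - r) := by
  simp [polarTerm, sub_sub_eq_add_sub]

theorem polarCoeff_polarTerm_self (j : ℕ) (a b : k) : polarCoeff j b (polarTerm j a b) = a := by
  have coe_C : (RatFunc.C a : LaurentSeries k) = HahnSeries.single 0 a := by
    simp [← RatFunc.algebraMap_C, ← IsScalarTower.algebraMap_apply]
  have expansion : (polarTerm j a 0 : LaurentSeries k) = HahnSeries.single (-j : ℤ) a := by
    rw [polarTerm, map_div₀, coe_C, div_eq_iff (by simp)]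
    simp
  rw [polarCoeff_apply, laurent_polarTerm, sub_self, expansion, HahnSeries.coeff_single_same]

theorem polarCoeff_polarTerm_of_ne {j : ℕ} [NeZero j] (a : k) {b c : k} (h : c ≠ b) :
    polarCoeff j c (polarTerm j a b) = 0 := by
  have hc : ((X - C b : k[X]) ^ j).eval c ≠ 0 := by
    simpa using pow_ne_zero j (sub_ne_zero.mpr h)
  simpa [polarTerm] using polarCoeff_div_of_eval_ne_zero (j := j) (C a) hc

theorem ratFuncCoeffAut_polarTerm (σ : RingAut k) (j : ℕ) (a b : k) :
    ratFuncCoeffAut σ (polarTerm j a b) = polarTerm j (σ a) (σ b) := by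
  simp [polarTerm, ← RatFunc.algebraMap_C, ← RatFunc.algebraMap_X]

end PolarCoeff

section DiscreteResidue

variable {k : Type*} [Field k] [CharZero k] {j : ℕ} [NeZero j]

theorem finite_support_polarCoeff_add_intCast (j : ℕ) [NeZero j] (b : k) (g : RatFunc k) :
    (Function.support fun n : ℤ => polarCoeff j (b + n) g).Finite :=
  (finite_setOf_polarCoeff_ne_zero j g).preimage
    ((add_right_injective b).comp Int.cast_injective).injOn

/-- The discrete residue of order `j` of a rational function at the class `b + ℤ`: the sum of its
coefficients of `(X - b') ^ (-j)` over all `b' ∈ b + ℤ`. -/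
noncomputable def discreteResidue (j : ℕ) [NeZero j] (b : k) : RatFunc k →+ k where
  toFun g := ∑ᶠ n : ℤ, polarCoeff j (b + n) g
  map_zero' := by simp
  map_add' g h := by
    simp only [map_add]
    exact finsum_add_distrib (finite_support_polarCoeff_add_intCast j b g)
      (finite_support_polarCoeff_add_intCast j b h)

theorem discreteResidue_apply (b : k) (g : RatFunc k) :
    discreteResidue j b g = ∑ᶠ n : ℤ, polarCoeff j (b + n) g :=
  rfl

theorem discreteResidue_add_intCast (b : k) (s : ℤ) (g : RatFunc k) :
    discreteResidue j (b + s) g = discreteResidue j b g := by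
  simpa [discreteResidue_apply, add_assoc] using
    finsum_comp_equiv (Equiv.addLeft s) (f := fun n : ℤ => polarCoeff j (b + n) g)

theorem discreteResidue_ratFuncShift (b : k) (g : RatFunc k) :
    discreteResidue j b (ratFuncShift k g) = discreteResidue j b g := by
  rw [← discreteResidue_add_intCast b 1 g]
  simp only [discreteResidue_apply, ratFuncShift_eq_laurent, polarCoeff_laurent, Int.cast_one,
    add_right_comm]

theorem discreteResidue_ratFuncCoeffAut (σ : RingAut k) (b : k) (g : RatFunc k) :
    discreteResidue j (σ b) (ratFuncCoeffAut σ g) = σ (discreteResidue j b g) := by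
  rw [discreteResidue_apply, discreteResidue_apply,
    map_finsum σ (finite_support_polarCoeff_add_intCast j b g)]
  simp only [← polarCoeff_ratFuncCoeffAut, map_add, map_intCast]

theorem discreteResidue_polarTerm_self (a b : k) : discreteResidue j b (polarTerm j a b) = a := by
  rw [discreteResidue_apply, finsum_eq_single _ 0, Int.cast_zero, add_zero,
    polarCoeff_polarTerm_self]
  exact fun n hn => polarCoeff_polarTerm_of_ne a (by simpa using hn)

theorem discreteResidue_polarTerm_of_ne (a : k) {b c : k} (h : ∀ s : ℤ, b + s ≠ c) :
    discreteResidue j b (polarTerm j a c) = 0 := by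
  simp only [discreteResidue_apply, polarCoeff_polarTerm_of_ne a (h _), finsum_zero]

theorem exists_polarCoeff_ne_zero_of_discreteResidue_ne_zero {b : k} {g : RatFunc k}
    (h : discreteResidue j b g ≠ 0) : ∃ n : ℤ, polarCoeff j (b + n) g ≠ 0 := by
  contrapose! h
  simp only [discreteResidue_apply, h, finsum_zero]

end DiscreteResidue

section OrbitResidue

variable {k : Type*} [Field k] [CharZero k] {j : ℕ} [NeZero j] {σ : RingAut k} {b : k}
  {f g h : RatFunc k}

theorem discreteResidue_summable (σ : RingAut k) (b : k) (g h : RatFunc k) :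
    discreteResidue j (σ b) ((ratFuncCoeffAut σ g - g) + (ratFuncShift k h - h)) =
      σ (discreteResidue j b g) - discreteResidue j (σ b) g := by
  rw [map_add, map_sub, map_sub, discreteResidue_ratFuncShift, sub_self, add_zero,
    discreteResidue_ratFuncCoeffAut]

theorem discreteResidue_pow_apply
    (hf : f = (ratFuncCoeffAut σ g - g) + (ratFuncShift k h - h)) {n : ℕ}
    (hvanish : ∀ m < n, discreteResidue j ((σ ^ (m + 1)) b) f = 0) :
    discreteResidue j ((σ ^ n) b) g = (σ ^ n) (discreteResidue j b g) := by
  induction n with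
  | zero => simp
  | succ n ih =>
    have hn := hvanish n n.lt_succ_self
    rw [pow_succ', RingAut.mul_apply, hf, discreteResidue_summable, sub_eq_zero] at hn
    rw [pow_succ', RingAut.mul_apply, RingAut.mul_apply, ← hn,
      ih fun m hm => hvanish m (hm.trans n.lt_succ_self)]

theorem exists_discreteResidue_pow_apply_eq_zero (j : ℕ) [NeZero j]
    (hfree : ∀ n : ℤ, n ≠ 0 → ∀ s : ℤ, (σ ^ n) b ≠ b + s) (g : RatFunc k) :
    ∃ n : ℕ, discreteResidue j ((σ ^ n) b) g = 0 := by
  by_contra! hne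
  choose s hs using fun n => exists_polarCoeff_ne_zero_of_discreteResidue_ne_zero (hne n)
  refine Set.infinite_of_injective_forall_mem (fun m n heq => ?_) hs
    (finite_setOf_polarCoeff_ne_zero j g)
  by_contra hmn
  refine hfree (m - n) (sub_ne_zero.mpr (mod_cast hmn)) (s n - s m) ((σ ^ n).injective ?_)
  rw [← zpow_natCast, ← RingAut.mul_apply, ← zpow_add, add_sub_cancel, map_add, map_intCast,
    zpow_natCast, zpow_natCast, Int.cast_sub]
  linear_combination heq

theorem discreteResidue_eq_zero_of_free
    (hf : f = (ratFuncCoeffAut σ g - g) + (ratFuncShift k h - h))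
    (hfree : ∀ n : ℤ, n ≠ 0 → ∀ s : ℤ, (σ ^ n) b ≠ b + s)
    (hvanish : ∀ n : ℤ, n ≠ 0 → discreteResidue j ((σ ^ n) b) f = 0) :
    discreteResidue j b g = 0 := by
  obtain ⟨n, hn⟩ := exists_discreteResidue_pow_apply_eq_zero j hfree g
  rwa [discreteResidue_pow_apply hf fun m _ => mod_cast hvanish (m + 1 : ℕ) (by lia),
    EmbeddingLike.map_eq_zero_iff] at hn

theorem exists_zpow_apply_eq_add_intCast_of_isSummablePair
    (hf : IsSummablePair (ratFuncCoeffAut σ) (ratFuncShift k) f) (hb : discreteResidue j b f ≠ 0)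
    (hvanish : ∀ n : ℤ, (∀ s : ℤ, (σ ^ n) b ≠ b + s) → discreteResidue j ((σ ^ n) b) f = 0) :
    ∃ n : ℤ, n ≠ 0 ∧ ∃ s : ℤ, (σ ^ n) b = b + s := by
  obtain ⟨g, h, hf⟩ := hf
  by_contra! hfree
  have hf_inv : f = (ratFuncCoeffAut σ⁻¹ (-ratFuncCoeffAut σ g) - -ratFuncCoeffAut σ g) +
      (ratFuncShift k h - h) := by
    rw [map_neg, ratFuncCoeffAut_inv, ← RingAut.mul_apply, inv_mul_cancel, RingAut.one_apply, hf]
    ring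
  have hg : discreteResidue j b g = 0 :=
    discreteResidue_eq_zero_of_free hf hfree fun n hn => hvanish n (hfree n hn)
  have hσg : discreteResidue j b (-ratFuncCoeffAut σ g) = 0 := by
    refine discreteResidue_eq_zero_of_free hf_inv ?_ ?_ <;> intro n hn <;> rw [inv_zpow']
    exacts [hfree _ (neg_ne_zero.mpr hn), hvanish _ (hfree _ (neg_ne_zero.mpr hn))]
  refine hb ?_
  rw [map_neg, neg_eq_zero] at hσg
  rw [hf, map_add, map_sub, map_sub, hσg, hg, discreteResidue_ratFuncShift, sub_self, sub_self,
    add_zero]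

theorem exists_discreteResidue_eq_pow_apply_sub_of_isSummablePair
    (hf : IsSummablePair (ratFuncCoeffAut σ) (ratFuncShift k) f) (hb : discreteResidue j b f ≠ 0)
    (hvanish : ∀ n : ℤ, (∀ s : ℤ, (σ ^ n) b ≠ b + s) → discreteResidue j ((σ ^ n) b) f = 0) :
    ∃ t : ℕ, 1 ≤ t ∧ (∃ s : ℤ, (σ ^ t) b = b + s) ∧
      ∃ γ : k, discreteResidue j b f = (σ ^ t) γ - γ := by
  classical
  obtain ⟨n, hn, s, hs⟩ := exists_zpow_apply_eq_add_intCast_of_isSummablePair hf hb hvanish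
  have hperiodic := exists_pow_apply_eq_add_intCast hn hs
  obtain ⟨ht, s, hs⟩ := Nat.find_spec hperiodic
  obtain ⟨m, hm⟩ := Nat.exists_eq_add_of_le' ht
  refine ⟨_, ht, ⟨s, hs⟩, ?_⟩
  obtain ⟨g, h, hf⟩ := hf
  have htransport : discreteResidue j ((σ ^ m) b) g = (σ ^ m) (discreteResidue j b g) :=
    discreteResidue_pow_apply hf fun i hi => mod_cast hvanish (i + 1 : ℕ) fun s heq =>
      Nat.find_min hperiodic (by lia) ⟨i.succ_pos, s, mod_cast heq⟩
  rw [hm] at hs ⊢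
  refine ⟨discreteResidue j b g, ?_⟩
  calc discreteResidue j b f
      = discreteResidue j ((σ ^ (m + 1)) b) f := by rw [hs, discreteResidue_add_intCast]
    _ = σ (discreteResidue j ((σ ^ m) b) g) - discreteResidue j ((σ ^ (m + 1)) b) g := by
        rw [pow_succ', RingAut.mul_apply, hf, discreteResidue_summable]
    _ = (σ ^ (m + 1)) (discreteResidue j b g) - discreteResidue j b g := by
        rw [htransport, hs, discreteResidue_add_intCast, pow_succ', RingAut.mul_apply]

end OrbitResidue

section PartialFractions

variable {k : Type*} [Field k] {j : ℕ} {σ : RingAut k} {b : k}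

/-- `a` and `b` lie in the same orbit of the group of transformations generated by `σ` and the
integer translations. -/
def ShiftEquivalent (σ : RingAut k) (a b : k) : Prop :=
  ∃ n s : ℤ, a - (σ ^ n) b = s

theorem ShiftEquivalent.symm {a b : k} (h : ShiftEquivalent σ a b) : ShiftEquivalent σ b a := by
  obtain ⟨n, s, h⟩ := h
  refine ⟨-n, -s, (σ ^ n).injective ?_⟩
  rw [map_sub, ← RingAut.mul_apply, ← zpow_add, add_neg_cancel, zpow_zero, RingAut.one_apply,
    map_intCast, Int.cast_neg]
  linear_combination -h

theorem pairwise_not_shiftEquivalent {ι : Type*} [LinearOrder ι] {β : ι → k}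
    (h : ∀ i i', i < i' → ¬ ShiftEquivalent σ (β i) (β i')) :
    Pairwise fun i i' => ¬ ShiftEquivalent σ (β i) (β i') := by
  intro i i' hne
  obtain hlt | hlt := hne.lt_or_gt
  · exact h i i' hlt
  · exact fun heq => h i' i hlt heq.symm

theorem ratFuncCoeffAut_pow_polarTerm (σ : RingAut k) (t j : ℕ) (a b : k) :
    (ratFuncCoeffAut σ ^ t) (polarTerm j a b) = polarTerm j ((σ ^ t) a) ((σ ^ t) b) := by
  induction t with
  | zero => simp
  | succ t ih =>
    simp only [pow_succ', RingAut.mul_apply, ih, ratFuncCoeffAut_polarTerm]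

theorem isSummablePair_polarTerm (j : ℕ) {t : ℕ} {s : ℤ} (h : (σ ^ t) b = b + s) (γ : k) :
    IsSummablePair (ratFuncCoeffAut σ) (ratFuncShift k) (polarTerm j ((σ ^ t) γ - γ) b) := by
  have hpole : (ratFuncShift k ^ s) ((ratFuncCoeffAut σ ^ t) (polarTerm j γ b)) =
      polarTerm j ((σ ^ t) γ) b := by
    rw [ratFuncCoeffAut_pow_polarTerm, ratFuncShift_zpow_eq_laurent, laurent_polarTerm, h,
      add_sub_cancel_right]
  rw [polarTerm_sub, ← hpole]
  exact mod_cast isSummablePair_zpow_apply_sub (t : ℤ) s (polarTerm j γ b)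

variable [CharZero k] [NeZero j] {ι : Type*} [Fintype ι] {α β : ι → k}

theorem discreteResidue_sum_polarTerm (α : ι → k) {i : ι}
    (h : ∀ i' ≠ i, ∀ s : ℤ, b + s ≠ β i') :
    discreteResidue j b (∑ i', polarTerm j (α i') (β i')) =
      discreteResidue j b (polarTerm j (α i) (β i)) := by
  rw [map_sum]
  exact Finset.sum_eq_single i
    (fun i' _ hi' => discreteResidue_polarTerm_of_ne (α i') (h i' hi'))
    fun hi => absurd (Finset.mem_univ i) hi

theorem isSummablePair_sum_polarTerm_iff (hα : ∀ i, α i ≠ 0)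
    (hβ : Pairwise fun i i' => ¬ ShiftEquivalent σ (β i) (β i')) :
    IsSummablePair (ratFuncCoeffAut σ) (ratFuncShift k) (∑ i, polarTerm j (α i) (β i)) ↔
      ∀ i, ∃ t : ℕ, 1 ≤ t ∧ (∃ s : ℤ, (σ ^ t) (β i) = β i + s) ∧ ∃ γ, α i = (σ ^ t) γ - γ := by
  refine ⟨fun hf i => ?_, fun h => .sum _ fun i _ => ?_⟩
  · have orbit_residue (n : ℤ) :
        discreteResidue j ((σ ^ n) (β i)) (∑ i', polarTerm j (α i') (β i')) =
          discreteResidue j ((σ ^ n) (β i)) (polarTerm j (α i) (β i)) :=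
      discreteResidue_sum_polarTerm α fun i' hi' s heq =>
        hβ hi' ⟨n, s, by rw [← heq, add_sub_cancel_left]⟩
    have residue : discreteResidue j (β i) (∑ i', polarTerm j (α i') (β i')) = α i := by
      simpa only [zpow_zero, RingAut.one_apply, discreteResidue_polarTerm_self] using
        orbit_residue 0
    simpa only [residue] using
      exists_discreteResidue_eq_pow_apply_sub_of_isSummablePair hf (by rw [residue]; exact hα i)
        fun n hn => (orbit_residue n).trans (discreteResidue_polarTerm_of_ne _ fun s heq =>
          hn (-s) (by rw [Int.cast_neg]; linear_combination heq))
  · obtain ⟨t, -, ⟨s, hs⟩, γ, hγ⟩ := h i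
    rw [hγ]
    exact isSummablePair_polarTerm j hs γ

end PartialFractions

section FieldExtensions

open Polynomial

open scoped IntermediateField

theorem nextCoeff_taylor {R : Type*} [CommSemiring R] (p : R[X]) (r : R) :
    (taylor r p).nextCoeff = p.nextCoeff + p.natDegree * p.leadingCoeff * r := by
  obtain hp | hp := p.natDegree.eq_zero_or_pos
  · simp [nextCoeff, hp]
  · rw [nextCoeff_of_natDegree_pos (by rwa [natDegree_taylor]), nextCoeff_of_natDegree_pos hp,
      natDegree_taylor, taylor_coeff, eval_eq_sum_range' (n := 2)]
    · obtain ⟨d, hd⟩ := Nat.exists_eq_add_of_le' hp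
      simp [Finset.sum_range_succ, hasseDeriv_coeff, leadingCoeff, hd, add_comm]
    · exact (natDegree_hasseDeriv_le p _).trans_lt (by lia)

/-- Comparing second coefficients of the minimal polynomials of `γ` and of its image `γ + a`
yields the rational solution. -/
theorem exists_apply_sub_eq_of_algebraMap {K L : Type*} [Field K] [CharZero K] [Field L]
    [Algebra K L] [Algebra.IsAlgebraic K L] {τ : RingAut K} {σ : RingAut L}
    (hσ : ∀ r, σ (algebraMap K L r) = algebraMap K L (τ r)) {γ : L} {a : K}
    (hγ : σ γ - γ = algebraMap K L a) : ∃ r, τ r - r = a := by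
  set p := minpoly K γ
  have hp : p.Monic := minpoly.monic (Algebra.IsIntegral.isIntegral γ)
  have hd : (p.natDegree : K) ≠ 0 :=
    mod_cast (minpoly.natDegree_pos (Algebra.IsIntegral.isIntegral γ)).ne'
  have hmap : p.map (τ : K →+* K) = taylor (-a) p := by
    have hcomp : (algebraMap K L).comp (τ : K →+* K) = (σ : L →+* L).comp (algebraMap K L) :=
      RingHom.ext fun r => (hσ r).symm
    rw [minpoly.map_eq_of_equiv_equiv (f := τ) (g := σ) hcomp, eq_add_of_sub_eq' hγ,
      minpoly.add_algebraMap, taylor_apply, C_neg, sub_eq_add_neg]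
  have hcoeff : τ p.nextCoeff = p.nextCoeff - p.natDegree * a := by
    have := congrArg nextCoeff hmap
    rwa [nextCoeff_map τ.injective, nextCoeff_taylor, hp.leadingCoeff, mul_one, mul_neg,
      ← sub_eq_add_neg] at this
  refine ⟨-p.nextCoeff / p.natDegree, ?_⟩
  rw [map_div₀, map_neg, map_natCast, hcoeff]
  field_simp
  ring

variable {F E : Type*} [Field F] [Field E] [Algebra F E]

theorem isAlgebraic_adjoin_simple_of_transcendental (hE : Algebra.trdeg F E = 1) {x : E}
    (hx : Transcendental F x) : Algebra.IsAlgebraic F⟮x⟯ E := by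
  have hind : AlgebraicIndependent F fun _ : Unit => x :=
    (algebraicIndependent_singleton_iff ()).mpr hx
  have hbasis := hind.isTranscendenceBasis_of_lift_trdeg_le_of_finite (by simp [hE])
  rw [← Set.range_const (ι := Unit) (c := x)]
  exact hbasis.isAlgebraic_field

theorem isAlgebraic_of_apply_eq (hE : Algebra.trdeg F E = 1) {τ : E ≃ₐ[F] E} {x y : E}
    (hx : τ x = x) (hy : Function.Injective fun n : ℕ => (τ ^ n) y) : IsAlgebraic F x := by
  by_contra htrans
  have := isAlgebraic_adjoin_simple_of_transcendental hE htrans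
  have hτ : τ ∈ F⟮x⟯.fixingSubgroup := (IntermediateField.mem_fixingSubgroup_iff _ τ).mpr <|
    (IntermediateField.forall_mem_adjoin_smul_eq_self_iff F τ).mpr (by simpa using hx)
  have hroot (n : ℕ) : (τ ^ n) y ∈ (minpoly F⟮x⟯ y).rootSet E := by
    let τ' := F⟮x⟯.fixingSubgroupEquiv ⟨τ ^ n, pow_mem hτ n⟩
    refine mem_rootSet.mpr ⟨minpoly.ne_zero (Algebra.IsIntegral.isIntegral y), ?_⟩
    change aeval (τ' y) (minpoly F⟮x⟯ y) = 0
    rw [aeval_algHom_apply, minpoly.aeval, map_zero]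
  exact Set.infinite_of_injective_forall_mem hy hroot (rootSet_finite _ _)

theorem trdeg_eq_one_of_isAlgebraic_ratFunc (F E : Type*) [Field F] [Field E] [Algebra F E]
    [Algebra (RatFunc F) E] [IsScalarTower F (RatFunc F) E] [Algebra.IsAlgebraic (RatFunc F) E] :
    Algebra.trdeg F E = 1 := by
  have : Algebra.IsAlgebraic F[X] (RatFunc F) :=
    IsLocalization.isAlgebraic (RatFunc F) (nonZeroDivisors F[X])
  have h : IsTranscendenceBasis F fun _ : Unit => algebraMap (RatFunc F) E RatFunc.X :=
    ((IsTranscendenceBasis.polynomial Unit F).algebraMap_comp (A := RatFunc F)).algebraMap_comp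
  simpa using h.lift_cardinalMk_eq_trdeg.symm

theorem isIntegrallyClosedIn_of_isAlgClosed (F A : Type*) [Field F] [IsAlgClosed F] [CommRing A]
    [IsDomain A] [Algebra F A] : IsIntegrallyClosedIn F A := by
  refine isIntegrallyClosedIn_iff.mpr ⟨FaithfulSMul.algebraMap_injective F A, fun {x} hx => ?_⟩
  have hdeg := IsAlgClosed.degree_eq_one_of_irreducible F (minpoly.irreducible hx)
  exact minpoly.mem_range_of_degree_eq_one F x hdeg

end FieldExtensions
namespace ExtendsShift

open scoped IntermediateField

variable {F : Type*} [Field F] {E : Type*} [Field E] [Algebra (RatFunc F) E] {σ : RingAut E}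

theorem pow_apply_algebraMap (hσ : ExtendsShift F σ) (n : ℕ) (a : RatFunc F) :
    (σ ^ n) (algebraMap (RatFunc F) E a) = algebraMap (RatFunc F) E ((ratFuncShift F ^ n) a) := by
  induction n with
  | zero => simp
  | succ n ih => rw [pow_succ', RingAut.mul_apply, ih, hσ, pow_succ', RingAut.mul_apply]

theorem pow_apply_X (hσ : ExtendsShift F σ) (n : ℕ) :
    (σ ^ n) (algebraMap (RatFunc F) E RatFunc.X) = algebraMap (RatFunc F) E RatFunc.X + n := by
  rw [hσ.pow_apply_algebraMap, ← zpow_natCast, ratFuncShift_zpow_eq_laurent, RatFunc.laurent_X]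
  simp

theorem exists_ratFunc_eq_pow_apply_sub [CharZero F] [Algebra.IsAlgebraic (RatFunc F) E]
    (hσ : ExtendsShift F σ) {t : ℕ} {a b γ : E} (hb : b ∈ (algebraMap (RatFunc F) E).range)
    (ha : a ∈ (RatFunc F)⟮b⟯) (hγ : a = (σ ^ t) γ - γ) :
    ∃ r : RatFunc F, a = (σ ^ t) (algebraMap (RatFunc F) E r) - algebraMap (RatFunc F) E r := by
  rw [IntermediateField.adjoin_simple_eq_bot_iff.mpr (IntermediateField.mem_bot.mpr hb),
    IntermediateField.mem_bot] at ha
  obtain ⟨a, rfl⟩ := ha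
  obtain ⟨r, rfl⟩ := exists_apply_sub_eq_of_algebraMap (hσ.pow_apply_algebraMap t) hγ.symm
  exact ⟨r, by rw [hσ.pow_apply_algebraMap, map_sub]⟩

variable [Algebra F E] [IsScalarTower F (RatFunc F) E]

theorem pow_apply_algebraMap_base (hσ : ExtendsShift F σ) (n : ℕ) (c : F) :
    (σ ^ n) (algebraMap F E c) = algebraMap F E c := by
  rw [IsScalarTower.algebraMap_apply F (RatFunc F) E, RatFunc.algebraMap_eq_C,
    hσ.pow_apply_algebraMap, ← zpow_natCast, ratFuncShift_zpow_eq_laurent, RatFunc.laurent_C]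

variable [CharZero F] [Algebra.IsAlgebraic (RatFunc F) E]

theorem isAlgebraic_of_pow_apply_eq (hσ : ExtendsShift F σ) {t : ℕ} (ht : t ≠ 0) {x : E}
    (hx : (σ ^ t) x = x) : IsAlgebraic F x := by
  have : CharZero E := charZero_of_injective_algebraMap (algebraMap F E).injective
  let τ : E ≃ₐ[F] E := .ofRingEquiv (f := σ ^ t) (hσ.pow_apply_algebraMap_base t)
  have orbit_X (n : ℕ) : (τ ^ n) (algebraMap (RatFunc F) E RatFunc.X) =
      algebraMap (RatFunc F) E RatFunc.X + n * t := by
    induction n with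
    | zero => simp
    | succ n ih =>
      rw [pow_succ', AlgEquiv.mul_apply, ih, map_add, map_mul, map_natCast, map_natCast]
      rw [show τ (algebraMap (RatFunc F) E RatFunc.X) = _ from hσ.pow_apply_X t]
      push_cast
      ring
  refine isAlgebraic_of_apply_eq (trdeg_eq_one_of_isAlgebraic_ratFunc F E) (τ := τ) hx
    (y := algebraMap (RatFunc F) E RatFunc.X) fun m n hmn => ?_
  simpa [orbit_X, ht] using hmn

theorem pow_apply_eq_add_intCast_iff [IsIntegrallyClosedIn F E] (hσ : ExtendsShift F σ) {t : ℕ}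
    (ht : t ≠ 0) {b : E} {s : ℤ} :
    (σ ^ t) b = b + s ↔
      ∃ c : F, b = s / t * algebraMap (RatFunc F) E RatFunc.X + algebraMap F E c := by
  have : CharZero E := charZero_of_injective_algebraMap (algebraMap F E).injective
  have ht' : (t : E) ≠ 0 := mod_cast ht
  have hline : (σ ^ t) (s / t * algebraMap (RatFunc F) E RatFunc.X) =
      s / t * algebraMap (RatFunc F) E RatFunc.X + s := by
    rw [map_mul, hσ.pow_apply_X, map_div₀, map_intCast, map_natCast]
    field_simp
  constructor
  · intro hb
    have hfixed : (σ ^ t) (b - s / t * algebraMap (RatFunc F) E RatFunc.X) =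
        b - s / t * algebraMap (RatFunc F) E RatFunc.X := by
      rw [map_sub, hb, hline, add_sub_add_right_eq_sub]
    obtain ⟨c, hc⟩ := IsIntegrallyClosedIn.algebraMap_eq_of_integral
      (hσ.isAlgebraic_of_pow_apply_eq ht hfixed).isIntegral
    exact ⟨c, by rw [hc, add_sub_cancel]⟩
  · rintro ⟨c, rfl⟩
    rw [map_add, hline, hσ.pow_apply_algebraMap_base, add_right_comm]

theorem isSummablePair_sum_polarTerm_iff [IsIntegrallyClosedIn F E] (hσ : ExtendsShift F σ)
    {j : ℕ} [NeZero j] {ι : Type*} [Fintype ι] {α β : ι → E} (hα : ∀ i, α i ≠ 0)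
    (hβ : Pairwise fun i i' => ¬ ShiftEquivalent σ (β i) (β i')) :
    IsSummablePair (ratFuncCoeffAut σ) (ratFuncShift E) (∑ i, polarTerm j (α i) (β i)) ↔
      ∀ i, ∃ (s : ℤ) (t : ℕ) (c : F), 1 ≤ t ∧
        β i = s / t * algebraMap (RatFunc F) E RatFunc.X + algebraMap F E c ∧
        ∃ γ : E, α i = (σ ^ t) γ - γ := by
  have : CharZero E := charZero_of_injective_algebraMap (algebraMap F E).injective
  rw [_root_.isSummablePair_sum_polarTerm_iff hα hβ]
  refine forall_congr' fun i => ⟨?_, ?_⟩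
  · rintro ⟨t, ht, ⟨s, hs⟩, hγ⟩
    obtain ⟨c, hc⟩ := (hσ.pow_apply_eq_add_intCast_iff (by lia)).mp hs
    exact ⟨s, t, c, ht, hc, hγ⟩
  · rintro ⟨s, t, c, ht, hc, hγ⟩
    exact ⟨t, ht, ⟨s, (hσ.pow_apply_eq_add_intCast_iff (by lia)).mpr ⟨c, hc⟩⟩, hγ⟩

end ExtendsShift

theorem theorem3p4_general {F : Type*} [Field F] [CharZero F] {E : Type*} [Field E] [Algebra F E]
    [Algebra (RatFunc F) E] [IsScalarTower F (RatFunc F) E] [Algebra.IsAlgebraic (RatFunc F) E]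
    [IsIntegrallyClosedIn F E] {σ : RingAut E} (hσ : ExtendsShift F σ) {j : ℕ} (hj : 1 ≤ j)
    {ι : Type*} [Fintype ι] {α β : ι → E} (hα : ∀ i, α i ≠ 0)
    (hβ : Pairwise fun i i' => ¬ ShiftEquivalent σ (β i) (β i')) :
    (IsSummablePair (ratFuncCoeffAut σ) (ratFuncShift E) (∑ i, polarTerm j (α i) (β i)) ↔
      ∀ i, ∃ (s : ℤ) (t : ℕ) (c : F), 1 ≤ t ∧
        β i = s / t * algebraMap (RatFunc F) E RatFunc.X + algebraMap F E c ∧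
        ∃ γ : E, α i = (σ ^ t) γ - γ) ∧
    ((∀ i, α i ∈ IntermediateField.adjoin (RatFunc F) {β i}) →
      (IsSummablePair (ratFuncCoeffAut σ) (ratFuncShift E) (∑ i, polarTerm j (α i) (β i)) ↔
        ∀ i, ∃ (s : ℤ) (t : ℕ) (c : F), 1 ≤ t ∧
          β i = s / t * algebraMap (RatFunc F) E RatFunc.X + algebraMap F E c ∧
          ∃ γ : RatFunc F, α i = (σ ^ t) (algebraMap (RatFunc F) E γ)
            - algebraMap (RatFunc F) E γ)) := by
  have : NeZero j := ⟨by lia⟩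
  have hiff := hσ.isSummablePair_sum_polarTerm_iff (j := j) hα hβ
  refine ⟨hiff, fun hadjoin => hiff.trans (forall_congr' fun i => ⟨?_, ?_⟩)⟩
  · rintro ⟨s, t, c, ht, hc, γ, hγ⟩
    have hβi : β i ∈ (algebraMap (RatFunc F) E).range :=
      ⟨(s : RatFunc F) / (t : RatFunc F) * RatFunc.X + algebraMap F (RatFunc F) c, by
        simp [hc, IsScalarTower.algebraMap_apply F (RatFunc F) E]⟩
    exact ⟨s, t, c, ht, hc, hσ.exists_ratFunc_eq_pow_apply_sub hβi (hadjoin i) hγ⟩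
  · rintro ⟨s, t, c, ht, hc, γ, hγ⟩
    exact ⟨s, t, c, ht, hc, algebraMap (RatFunc F) E γ, hγ⟩

theorem theorem3p4 {F : Type*} [Field F] [IsAlgClosed F] [CharZero F]
    {E : Type*} [Field E] [Algebra (RatFunc F) E] [IsAlgClosure (RatFunc F) E]
    (σ : RingAut E) (hσ : ExtendsShift F σ)
    (m j : ℕ) (hj : 1 ≤ j) (α β : Fin m → E) (hα : ∀ i, α i ≠ 0)
    (hβ : ∀ i i' : Fin m, i < i' → ∀ n k : ℤ, β i - (σ ^ n) (β i') ≠ (k : E))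
    (f : RatFunc E)
    (hf : f = ∑ i, RatFunc.C (α i) / (RatFunc.X - RatFunc.C (β i)) ^ j) :
    (IsSummablePair (ratFuncCoeffAut σ) (ratFuncShift E) f ↔
      ∀ i, ∃ (s : ℤ) (t : ℕ) (c : F), 1 ≤ t ∧
        β i = (s : E) / (t : E) * algebraMap (RatFunc F) E RatFunc.X
          + algebraMap (RatFunc F) E (RatFunc.C c) ∧
        ∃ γ : E, α i = (σ ^ t) γ - γ) ∧
    ((∀ i, α i ∈ IntermediateField.adjoin (RatFunc F) {β i}) →
      (IsSummablePair (ratFuncCoeffAut σ) (ratFuncShift E) f ↔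
        ∀ i, ∃ (s : ℤ) (t : ℕ) (c : F), 1 ≤ t ∧
          β i = (s : E) / (t : E) * algebraMap (RatFunc F) E RatFunc.X
            + algebraMap (RatFunc F) E (RatFunc.C c) ∧
          ∃ γ : RatFunc F, α i = (σ ^ t) (algebraMap (RatFunc F) E γ)
            - algebraMap (RatFunc F) E γ)) := by
  subst hf
  let : Algebra F E := ((algebraMap (RatFunc F) E).comp RatFunc.C).toAlgebra
  have : IsScalarTower F (RatFunc F) E := .of_algebraMap_eq fun _ => rfl
  have : Algebra.IsAlgebraic (RatFunc F) E := IsAlgClosure.isAlgebraic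
  have : IsIntegrallyClosedIn F E := isIntegrallyClosedIn_of_isAlgClosed F E
  exact theorem3p4_general hσ hj hα
    (pairwise_not_shiftEquivalent fun i i' hlt ⟨n, s, h⟩ => hβ i i' hlt n s h)
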